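/- Let $\mathrm{Im}\,\tau>0$, $p=e^{2\pi i\tau}$, let $N,M\in\mathbb Z$ be coprime, $\chi\in\mathbb R$ irrational, and put $q^x=e^{2\pi i\chi x(N+M\tau)}$ for $x\in\mathbb R$ (so $q=e^{2\pi i\chi(N+M\tau)}$). Let $\theta(z;p)=\prod_{n\ge0}(1-zp^n)(1-p^{n+1}z^{-1})$, $\theta(t;p;q)_n=\prod_{m=0}^{n-1}\theta(tq^m;p)$, and consider the series $${}_{r+1}E_r\left({t_0,t_1,\dots,t_r\atop w_1,\dots,w_r};q,p\Big|z\right)=\sum_{n=0}^\infty \frac{\theta(t_0;p;q)_n\theta(t_1;p;q)_n\cdots\theta(t_r;p;q)_n}{\theta(q;p;q)_n\theta(w_1;p;q)_n\cdots\theta(w_r;p;q)_n}z^n,\qquad t_0=q,$$ with radius of convergence $r_c$ in $z$. Let $r>2$ be an integer, $k\ge0$ an integer with $k+1\le r/2$, $\lambda$ real with $0<\lambda<1-\frac2r$, and $\varepsilon=\frac{k+1}{r/2+\lambda}$. Put $$\varphi_1=1+\frac{\varepsilon r}{2},\qquad \varphi_2=\dots=\varphi_r=1-\varepsilon,$$ and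 let $h_1,\dots,h_r$ be arbitrary real numbers. Let $\tilde\varphi_j,\tilde h_j$ be real numbers determined by the conditions $\tilde\varphi_i+\varphi_i=\tilde\varphi_j+\varphi_j$, $\tilde h_i+h_i=\tilde h_j+h_j$, $\sum_j\tilde\varphi_j=\sum_j\varphi_j$, $\sum_j\tilde h_j=\sum_j h_j$, and set $$t_j=q^{h_j}e^{\varphi_j\frac{2\pi\,\mathrm{Im}\,\tau}{N+M\bar\tau}},\qquad w_j=q^{\tilde h_j}e^{\tilde\varphi_j\frac{2\pi\,\mathrm{Im}\,\tau}{N+M\bar\tau}},\qquad j=1,\dots,r.$$ Then $\tilde\varphi_1=1-\varepsilon(1-\frac2r+\frac r2)$ and $\tilde\varphi_j=1+\frac{2\varepsilon}{r}$ for $j\ge2$; no $t_j$ or $w_j$ lies on any of the curves $p^mq^{\mathbb R}$, $m\in\mathbb Z$; the series is well defined, does not terminate, is well-poised ($t_1w_1=\dots=t_rw_r$) and balanced ($\prod_{j=0}^rt_j=q\prod_{j=1}^rw_j$); and $0<r_c<\infty$ with $$\log r_c^{-1}=\frac{\varepsilon\,\pi\,\mathrm{Im}\,\tau}{|N+M\tau|^2}\Big(2\lambda+\big(\tfrac2r-1\big)(2k+4-r)\Big).$$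 If moreover $k=\lfloor\frac{r-2}{2}\rfloor$ and either $r$ is even, or $r$ is odd and $2\lambda<1-\frac2r$, then $\log r_c^{-1}<0$, i.e. $r_c>1$. In particular, for all such $\tau,N,M,\chi$ and every integer $r>2$, even or odd, there are parameters $t_1,\dots,t_r,w_1,\dots,w_r$, none of them on the curves $p^mq^{\mathbb R}$, for which the non-terminating well-poised balanced ${}_{r+1}E_r$ series with $t_0=q$ has radius of convergence strictly bigger than $1$. -/

import Mathlib

open scoped BigOperators

noncomputable section

namespace EllipticSeries

/-- The infinite product `(a; p)_∞ = ∏_{n ≥ 0} (1 - a p ^ n)`, for `|p| < 1`. -/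
def pPochInf (a p : ℂ) : ℂ := ∏' n : ℕ, (1 - a * p ^ n)

/-- The theta function `θ(z; p) = (z; p)_∞ (p z⁻¹; p)_∞`. -/
def theta (z p : ℂ) : ℂ := pPochInf z p * pPochInf (p * z⁻¹) p

/-- The elliptic Pochhammer symbol `θ(t; p; q)_n = ∏_{m < n} θ(t q ^ m; p)`. -/
def ellPoch (t p q : ℂ) (n : ℕ) : ℂ := ∏ m ∈ Finset.range n, theta (t * q ^ m) p

/-- The denominator `θ(q, w_1, …, w_r; p; q)_n` of the `n`-th coefficient of `_sE_r`. -/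
def coeffDenom {r : ℕ} (w : Fin r → ℂ) (q p : ℂ) (n : ℕ) : ℂ :=
  ellPoch q p q n * ∏ j, ellPoch (w j) p q n

/-- The coefficient of `z ^ n` in the theta hypergeometric series
`_sE_r(t_0, …, t_{s-1}; w_1, …, w_r; q, p | z)`. -/
def coeffE {s r : ℕ} (t : Fin s → ℂ) (w : Fin r → ℂ) (q p : ℂ) (n : ℕ) : ℂ :=
  (∏ i, ellPoch (t i) p q n) / coeffDenom w q p n

/-- The radius of convergence in `z` of `_sE_r(t; w; q, p | z)`. -/
def radiusE {s r : ℕ} (t : Fin s → ℂ) (w : Fin r → ℂ) (q p : ℂ) : ENNReal :=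
  (FormalMultilinearSeries.ofScalars ℂ (coeffE t w q p)).radius

/-- The base `p = exp(2πiτ)`. -/
def base (τ : ℂ) : ℂ := Complex.exp (2 * Real.pi * Complex.I * τ)

/-- The real powers `q ^ x = exp(2πiχx(N + Mτ))` of `q = exp(2πiχ(N + Mτ))`. -/
def qPow (τ : ℂ) (N M : ℤ) (χ x : ℝ) : ℂ :=
  Complex.exp (2 * Real.pi * Complex.I * χ * x * (N + M * τ))

/-- The parameter `q ^ h * exp(φ * 2π Im τ / (N + M τ̄))`. -/
def param (τ : ℂ) (N M : ℤ) (χ h φ : ℝ) : ℂ :=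
  qPow τ N M χ h *
    Complex.exp (φ * (2 * Real.pi * τ.im / (N + M * (starRingEnd ℂ) τ)))

/-- `t_0 = q` and `t_1, …, t_r`, `w_1, …, w_r` are the parameters of a non-terminating, well-poised
and balanced `_{r+1}E_r` series: all numerators and denominators of the coefficients are non-zero,
`∏_{k=0}^r t_k = q ∏_{k=1}^r w_k` and `t_1 w_1 = … = t_r w_r`. -/
structure IsWellPoisedBalanced {r : ℕ} (t : Fin (r + 1) → ℂ) (w : Fin r → ℂ) (q p : ℂ) :
    Prop where
  zero_eq : t 0 = q
  numer_ne_zero : ∀ n : ℕ, ∏ i, ellPoch (t i) p q n ≠ 0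
  denom_ne_zero : ∀ n : ℕ, coeffDenom w q p n ≠ 0
  balanced : ∏ i, t i = q * ∏ j, w j
  wellPoised : ∀ i j : Fin r, t i.succ * w i = t j.succ * w j

/-- None of the `t_j`, `w_j` lies on one of the curves `q ^ ℝ * p ^ m`, `m ∈ ℤ`. -/
def OffLine {r : ℕ} (τ : ℂ) (N M : ℤ) (χ : ℝ) (t w : Fin r → ℂ) : Prop :=
  ∀ (j : Fin r) (x : ℝ) (m : ℤ),
    t j ≠ qPow τ N M χ x * base τ ^ m ∧ w j ≠ qPow τ N M χ x * base τ ^ m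

end EllipticSeries

end

/-! Write points as exp(2πiσv) with σ = N + Mτ. Multiplication by q becomes v ↦ v + χ, and a
parameter with exponent φ has Im v = -φT, where T = Im τ / |σ|² is `height`. A Gaussian factor turns
θ into `modTheta`, which only picks up a unimodular constant under v ↦ v + 1. Well-poisedness and
balancing together cancel the Gaussians from the coefficients (`prod_theta_div_eq`), and t_0 = q
cancels θ(q;p;q)_n. So the log-modulus of the n-th coefficient is a sum of a continuous 1-periodic
function over the points mχ, m < n. Weyl's theorem (`tendsto_average_of_periodic`) and the root test
express r_c through means of log|`modTheta`| over horizontal unit segments (`radiusE_eq`).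

The zeros of `modTheta` lie on the lines Im v ∈ Tℤ, and between them the mean is affine in the
height (`exists_segmentMean_sub`). Evenness and quasi-periodicity in the second period fix all
slopes: at height φT the mean is c + πT·G(φ), where G interpolates φ² linearly between integers
(`exists_segmentMean_modTheta`). The two parameter conditions force Σφ_j² = Σφ̃_j², so log r_c⁻¹
equals πT times the difference of the sums of the interpolation errors {φ}(1 - {φ}). This can be
negative. The special exponents have explicit floors, so the value is a finite computation
(`radiusE_special`), with sign settled by `factor_neg`. -/

namespace EllipticSeries

open Filter Topology

/-! ### The theta function: analyticity, functional equations, zeros. -/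

section Theta

variable {p : ℂ}

lemma summable_norm_mul_pow (hp : ‖p‖ < 1) (a : ℂ) : Summable fun n : ℕ => ‖-(a * p ^ n)‖ := by
  simpa using (summable_geometric_of_lt_one (norm_nonneg _) hp).mul_left ‖a‖

lemma multipliable_one_sub_mul_pow (hp : ‖p‖ < 1) (a : ℂ) :
    Multipliable fun n : ℕ => 1 - a * p ^ n := by
  simpa [sub_eq_add_neg] using multipliable_one_add_of_summable (summable_norm_mul_pow hp a)

lemma pPochInf_eq_mul (hp : ‖p‖ < 1) (a : ℂ) :
    pPochInf a p = (1 - a) * pPochInf (a * p) p := by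
  have e : ∀ n : ℕ, 1 - a * p ^ (n + 1) = 1 - a * p * p ^ n := fun n => by ring
  have h : Multipliable fun n : ℕ => 1 - a * p ^ (n + 1) := by
    simpa only [e] using multipliable_one_sub_mul_pow hp (a * p)
  have := tprod_eq_zero_mul' (f := fun n : ℕ => 1 - a * p ^ n) h
  simpa only [pPochInf, e, pow_zero, mul_one] using this

lemma pPochInf_ne_zero (hp : ‖p‖ < 1) {a : ℂ} (ha : ∀ n : ℕ, a * p ^ n ≠ 1) :
    pPochInf a p ≠ 0 := by
  have := tprod_one_add_ne_zero_of_summable (f := fun n : ℕ => -(a * p ^ n))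
    (fun n => by simpa [← sub_eq_add_neg, sub_ne_zero] using (ha n).symm)
    (summable_norm_mul_pow hp a)
  simpa [pPochInf, sub_eq_add_neg] using this

lemma differentiable_pPochInf (hp : ‖p‖ < 1) : Differentiable ℂ fun a => pPochInf a p := by
  intro a
  -- Any ball containing `a` would do: on it the product converges locally uniformly, dominated by a
  -- geometric series.
  have h : DifferentiableOn ℂ (fun a => pPochInf a p) (Metric.ball 0 (‖a‖ + 1)) := by
    have hs : Summable fun n : ℕ => (‖a‖ + 1) * ‖p‖ ^ n :=
      (summable_geometric_of_lt_one (norm_nonneg _) hp).mul_left _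
    have := Summable.hasProdLocallyUniformlyOn_nat_one_add
      (f := fun (n : ℕ) (x : ℂ) => -(x * p ^ n)) Metric.isOpen_ball hs
      (K := Metric.ball (0 : ℂ) (‖a‖ + 1))
      (.of_forall fun n x hx => by
        rw [norm_neg, norm_mul, norm_pow]
        have : ‖x‖ < ‖a‖ + 1 := by simpa using hx
        gcongr)
      (fun n => by fun_prop)
    have h2 := this.differentiableOn (.of_forall fun s => by
      simpa [Finset.prod_fn] using DifferentiableOn.finsetProd (fun _ _ ↦ by fun_prop))
      Metric.isOpen_ball
    simpa [pPochInf, sub_eq_add_neg] using h2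
  exact h.differentiableAt (Metric.isOpen_ball.mem_nhds (by simp))

lemma theta_mul_self (hp : ‖p‖ < 1) (hp0 : p ≠ 0) {z : ℂ} (hz : z ≠ 0) :
    theta (z * p) p = -z⁻¹ * theta z p := by
  have h1 : p * (z * p)⁻¹ = z⁻¹ := by field_simp
  rw [theta, theta, h1, pPochInf_eq_mul hp z, pPochInf_eq_mul hp z⁻¹, mul_comm z⁻¹ p]
  field_simp
  ring

lemma theta_inv (hp : ‖p‖ < 1) (hp0 : p ≠ 0) {z : ℂ} (hz : z ≠ 0) :
    theta z⁻¹ p = -z⁻¹ * theta z p := by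
  rw [← theta_mul_self hp hp0 hz, theta, theta, inv_inv]
  have h1 : p * (z * p)⁻¹ = z⁻¹ := by field_simp
  rw [h1, mul_comm, mul_comm p z]

lemma theta_ne_zero (hp : ‖p‖ < 1) {z : ℂ} (hz0 : z ≠ 0)
    (hz : ∀ m : ℤ, z ≠ p ^ m) : theta z p ≠ 0 := by
  refine mul_ne_zero (pPochInf_ne_zero hp fun n h => hz (-n) ?_)
    (pPochInf_ne_zero hp fun n h => hz (n + 1) ?_)
  · rw [zpow_neg, zpow_natCast]
    exact eq_inv_of_mul_eq_one_left h
  · have : z ≠ 0 := hz0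
    field_simp at h
    rw [← h]
    norm_cast
    ring

end Theta

end EllipticSeries

namespace EllipticSeries

open Filter Topology

/-! ### Theta renormalised along the primitive period σ = N + Mτ. -/

section ModifiedTheta

variable {τ : ℂ}

lemma norm_base_lt_one (hτ : 0 < τ.im) : ‖base τ‖ < 1 :=
  UpperHalfPlane.norm_exp_two_pi_I_lt_one ⟨τ, hτ⟩

lemma base_ne_zero (τ : ℂ) : base τ ≠ 0 := Complex.exp_ne_zero _

/-- The odd theta function `exp(-πiu) θ(exp(2πiu); p)`. -/
noncomputable def oddTheta (τ u : ℂ) : ℂ :=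
  Complex.exp (-(Real.pi * Complex.I * u)) *
    theta (Complex.exp (2 * Real.pi * Complex.I * u)) (base τ)

lemma oddTheta_add_one (τ u : ℂ) :
    oddTheta τ (u + 1) = Complex.exp (Real.pi * Complex.I) * oddTheta τ u := by
  have h1 : Complex.exp (2 * Real.pi * Complex.I * (u + 1)) =
      Complex.exp (2 * Real.pi * Complex.I * u) := by
    rw [mul_add, Complex.exp_add, mul_one, Complex.exp_two_pi_mul_I, mul_one]
  have h2 : Complex.exp (-(Real.pi * Complex.I * (u + 1))) =
      Complex.exp (Real.pi * Complex.I) * Complex.exp (-(Real.pi * Complex.I * u)) := by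
    rw [mul_add, neg_add, Complex.exp_add, mul_one, Complex.exp_neg (Real.pi * Complex.I),
      Complex.exp_pi_mul_I]
    norm_num
  rw [oddTheta, oddTheta, h1, h2, mul_assoc]

/-- Signs are kept as exponentials, so that multipliers combine by adding exponents. -/
lemma neg_eq_exp_pi_mul_I_mul (x : ℂ) : -x = Complex.exp (Real.pi * Complex.I) * x := by
  rw [Complex.exp_pi_mul_I, neg_one_mul]

lemma oddTheta_add_tau (hτ : 0 < τ.im) (u : ℂ) :
    oddTheta τ (u + τ) =
      Complex.exp (Real.pi * Complex.I * (1 - (τ + 2 * u))) * oddTheta τ u := by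
  have h1 : Complex.exp (2 * Real.pi * Complex.I * (u + τ)) =
      Complex.exp (2 * Real.pi * Complex.I * u) * base τ := by
    rw [mul_add, Complex.exp_add, base]
  rw [oddTheta, oddTheta, h1, theta_mul_self (norm_base_lt_one hτ) (base_ne_zero τ)
    (Complex.exp_ne_zero _), ← Complex.exp_neg, neg_mul,
    neg_eq_exp_pi_mul_I_mul (Complex.exp _ * _)]
  simp only [← mul_assoc, ← Complex.exp_add]
  ring_nf

lemma oddTheta_neg (hτ : 0 < τ.im) (u : ℂ) : oddTheta τ (-u) = -oddTheta τ u := by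
  have h1 : Complex.exp (2 * Real.pi * Complex.I * -u) =
      (Complex.exp (2 * Real.pi * Complex.I * u))⁻¹ := by
    rw [← Complex.exp_neg, mul_neg]
  have h2 : Complex.exp (-(Real.pi * Complex.I * -u)) *
      (Complex.exp (2 * Real.pi * Complex.I * u))⁻¹ =
        Complex.exp (-(Real.pi * Complex.I * u)) := by
    rw [← Complex.exp_neg, ← Complex.exp_add]
    ring_nf
  rw [oddTheta, oddTheta, h1, theta_inv (norm_base_lt_one hτ) (base_ne_zero τ)
    (Complex.exp_ne_zero _), ← h2]
  ring

lemma oddTheta_add_int (τ u : ℂ) (a : ℤ) :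
    oddTheta τ (u + a) = Complex.exp (Real.pi * Complex.I * a) * oddTheta τ u := by
  induction a using Int.induction_on with
  | zero => simp
  | succ n ih =>
    have := oddTheta_add_one τ (u + n)
    push_cast at ih ⊢
    rw [← add_assoc, this, ih, ← mul_assoc, ← Complex.exp_add]
    ring_nf
  | pred n ih =>
    have := oddTheta_add_one τ (u + (-n - 1))
    push_cast at ih ⊢
    have e : u + (-n - 1) + 1 = u + -(n : ℂ) := by ring
    rw [e, ih] at this
    rw [sub_eq_add_neg, mul_add, Complex.exp_add, mul_neg_one, mul_comm (Complex.exp _), mul_assoc,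
      ← sub_eq_add_neg, this, ← mul_assoc, ← Complex.exp_add]
    simp

lemma oddTheta_add_int_mul_tau (hτ : 0 < τ.im) (u : ℂ) (b : ℤ) :
    oddTheta τ (u + b * τ) =
      Complex.exp (Real.pi * Complex.I * (b - (b ^ 2 * τ + 2 * b * u))) * oddTheta τ u := by
  induction b using Int.induction_on with
  | zero => simp
  | succ n ih =>
    have := oddTheta_add_tau hτ (u + n * τ)
    push_cast at ih ⊢
    rw [add_one_mul, ← add_assoc, this, ih, ← mul_assoc, ← Complex.exp_add]
    ring_nf
  | pred n ih =>
    have := oddTheta_add_tau hτ (u + (-n - 1) * τ)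
    push_cast at ih ⊢
    have e : u + (-n - 1) * τ + τ = u + -(n : ℂ) * τ := by ring
    rw [e, ih] at this
    apply mul_left_cancel₀ (Complex.exp_ne_zero _)
    rw [← this, ← mul_assoc, ← Complex.exp_add]
    ring_nf

lemma oddTheta_add_lattice (hτ : 0 < τ.im) (u : ℂ) (a b : ℤ) :
    oddTheta τ (u + (a + b * τ)) =
      Complex.exp (Real.pi * Complex.I * (a + b - (b ^ 2 * τ + 2 * b * u))) * oddTheta τ u := by
  have e : u + (a + b * τ) = u + b * τ + a := by ring
  rw [e, oddTheta_add_int, oddTheta_add_int_mul_tau hτ, ← mul_assoc, ← Complex.exp_add]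
  ring_nf

lemma exists_lattice_of_oddTheta_eq_zero (hτ : 0 < τ.im) {u : ℂ} (h : oddTheta τ u = 0) :
    ∃ a b : ℤ, u = a + b * τ := by
  by_contra! hu
  refine mul_ne_zero (Complex.exp_ne_zero _) (theta_ne_zero (norm_base_lt_one hτ)
    (Complex.exp_ne_zero _) fun m hm => ?_) h
  rw [base, ← Complex.exp_int_mul, Complex.exp_eq_exp_iff_exists_int] at hm
  obtain ⟨n, hn⟩ := hm
  refine hu n m (mul_left_cancel₀ Complex.two_pi_I_ne_zero ?_)
  rw [hn]
  ring

lemma differentiable_oddTheta (hτ : 0 < τ.im) : Differentiable ℂ (oddTheta τ) := by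
  have h := differentiable_pPochInf (norm_base_lt_one hτ)
  have e : oddTheta τ = fun u => Complex.exp (-(Real.pi * Complex.I * u)) *
      (pPochInf (Complex.exp (2 * Real.pi * Complex.I * u)) (base τ) *
        pPochInf (base τ * Complex.exp (-(2 * Real.pi * Complex.I * u))) (base τ)) := by
    ext u
    rw [oddTheta, theta, Complex.exp_neg (2 * Real.pi * Complex.I * u)]
  rw [e]
  refine Differentiable.mul (by fun_prop) (Differentiable.mul ?_ ?_)
  · exact h.comp (g := fun a => pPochInf a (base τ)) (by fun_prop)
  · exact h.comp (g := fun a => pPochInf a (base τ)) (by fun_prop)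

/-- The direction `N + Mτ` of the curve `q ^ ℝ`. -/
noncomputable def period (τ : ℂ) (N M : ℤ) : ℂ := N + M * τ

/-- The imaginary part of the modulus of the lattice `ℤ + ℤτ` rescaled by a primitive period. -/
noncomputable def height (τ : ℂ) (N M : ℤ) : ℝ := τ.im / ‖period τ N M‖ ^ 2

lemma period_ne_zero (hτ : 0 < τ.im) {N M : ℤ} (h : IsCoprime N M) : period τ N M ≠ 0 := by
  intro h0
  have hM : (M : ℝ) * τ.im = 0 := by simpa [period] using congrArg Complex.im h0
  have hM' : M = 0 := by simpa [hτ.ne'] using hM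
  subst hM'
  have : N = 0 := by simpa [period] using h0
  subst this
  exact not_isUnit_zero (isCoprime_zero_left.1 h)

lemma height_pos (hτ : 0 < τ.im) {N M : ℤ} (h : IsCoprime N M) : 0 < height τ N M :=
  div_pos hτ (pow_pos (norm_pos_iff.2 (period_ne_zero hτ h)) 2)

/-- Dividing the lattice by σ places it on equally spaced horizontal lines; this locates the zeros
of `modTheta`. -/
lemma im_of_period_mul_eq (hτ : 0 < τ.im) {N M : ℤ} (h : IsCoprime N M) {v : ℂ} {a b : ℤ}
    (hv : period τ N M * v = a + b * τ) : v.im = (N * b - M * a : ℤ) * height τ N M := by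
  have hp := period_ne_zero hτ h
  have hn : ‖period τ N M‖ ^ 2 ≠ 0 := pow_ne_zero 2 (norm_ne_zero_iff.2 hp)
  rw [height, mul_div_assoc', eq_div_iff hn, ← Complex.normSq_eq_norm_sq]
  have hre := congrArg Complex.re hv
  have him := congrArg Complex.im hv
  simp only [period, Complex.mul_re, Complex.mul_im, Complex.add_re, Complex.add_im,
    Complex.intCast_re, Complex.intCast_im, Complex.normSq_apply] at hre him ⊢
  push_cast
  -- The imaginary part of `hv` multiplied by the conjugate of σ.
  linear_combination (N + M * τ.re) * him - (M * τ.im) * hre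

/-- The theta function `exp(πiMσv²) exp(-πiσv) θ(exp(2πiσv); p)`, `σ = N + Mτ`, which is periodic
up to a constant factor with respect to `v ↦ v + 1`. -/
noncomputable def modTheta (τ : ℂ) (N M : ℤ) (v : ℂ) : ℂ :=
  Complex.exp (Real.pi * Complex.I * (M * period τ N M * v ^ 2)) * oddTheta τ (period τ N M * v)

variable {N M : ℤ}

/-- The Gaussian contributes Mσ(2v + 1) and the lattice shift -(M²τ + 2Mσv). The terms in v cancel
and Mσ - M²τ = MN is real, so the multiplier is unimodular. -/
lemma modTheta_add_one (hτ : 0 < τ.im) (v : ℂ) :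
    modTheta τ N M (v + 1) =
      Complex.exp ((Real.pi * (M * N + N + M) : ℝ) * Complex.I) * modTheta τ N M v := by
  have := oddTheta_add_lattice hτ (period τ N M * v) N M
  have e : period τ N M * (v + 1) = period τ N M * v + (N + M * τ) := by rw [period]; ring
  rw [modTheta, modTheta, e, this]
  simp only [← mul_assoc, ← Complex.exp_add]
  congr 2
  rw [period]
  push_cast
  ring

lemma modTheta_neg (hτ : 0 < τ.im) (v : ℂ) : modTheta τ N M (-v) = -modTheta τ N M v := by
  rw [modTheta, modTheta, mul_neg, oddTheta_neg hτ]
  ring_nf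

/-- The modular transformation of theta: determinant 1 makes `modTheta` behave, up to a unimodular
constant, like the odd theta function of modulus τ'. -/
lemma modTheta_add_modulus (hτ : 0 < τ.im) {K L : ℤ} (hKL : N * L - M * K = 1) {τ' : ℂ}
    (hτ' : period τ N M * τ' = K + L * τ) (v : ℂ) :
    modTheta τ N M (v + τ') =
      Complex.exp ((Real.pi * (K + L + K * L) : ℝ) * Complex.I) *
        Complex.exp (-(Real.pi * Complex.I * (τ' + 2 * v))) * modTheta τ N M v := by
  have := oddTheta_add_lattice hτ (period τ N M * v) K L
  have e : period τ N M * (v + τ') = period τ N M * v + (K + L * τ) := by rw [mul_add, hτ']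
  rw [modTheta, modTheta, e, this]
  simp only [← mul_assoc, ← Complex.exp_add]
  congr 2
  have hKL' : (N * L - M * K : ℂ) = 1 := by exact_mod_cast hKL
  rw [period] at hτ' ⊢
  push_cast
  linear_combination Real.pi * Complex.I * ((2 * v * M + M * τ' + L) * hτ' - (2 * v + τ') * hKL')

lemma differentiable_modTheta (hτ : 0 < τ.im) : Differentiable ℂ (modTheta τ N M) := by
  have h := differentiable_oddTheta hτ
  unfold modTheta
  fun_prop

lemma modTheta_ne_zero (hτ : 0 < τ.im) (hNM : IsCoprime N M) {v : ℂ}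
    (hv : ∀ m : ℤ, v.im ≠ m * height τ N M) : modTheta τ N M v ≠ 0 := by
  intro h
  obtain ⟨a, b, hab⟩ := exists_lattice_of_oddTheta_eq_zero hτ
    ((mul_eq_zero.1 h).resolve_left (Complex.exp_ne_zero _))
  exact hv _ (im_of_period_mul_eq hτ hNM hab)

end ModifiedTheta

end EllipticSeries

namespace EllipticSeries

open Filter Topology MeasureTheory

/-! ### Weyl equidistribution through Fourier approximation. -/

section Weyl

lemma tendsto_average_pow {w : ℂ} (hw : ‖w‖ = 1) (hw1 : w ≠ 1) :
    Tendsto (fun n : ℕ => (n : ℂ)⁻¹ * ∑ m ∈ Finset.range n, w ^ m) atTop (𝓝 0) := by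
  have hb : ∀ n : ℕ, ‖(n : ℂ)⁻¹ * ∑ m ∈ Finset.range n, w ^ m‖ ≤ (2 / ‖w - 1‖) * (n : ℝ)⁻¹ := by
    intro n
    rw [geom_sum_eq hw1, norm_mul, norm_inv, Complex.norm_natCast, norm_div, mul_comm]
    gcongr
    calc ‖w ^ n - 1‖ ≤ ‖w ^ n‖ + ‖(1 : ℂ)‖ := norm_sub_le _ _
      _ = 2 := by rw [norm_pow, hw]; norm_num
  refine squeeze_zero_norm hb ?_
  simpa using (tendsto_inv_atTop_nhds_zero_nat (𝕜 := ℝ)).const_mul (2 / ‖w - 1‖)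

/-- The difference between the average of `f` over the orbit of `0` and its mean. -/
noncomputable def averageError (χ : ℝ) (n : ℕ) (f : C(AddCircle (1 : ℝ), ℂ)) : ℂ :=
  (n : ℂ)⁻¹ * ∑ m ∈ Finset.range n, f ((m * χ : ℝ) : AddCircle (1 : ℝ)) -
    ∫ x in (0 : ℝ)..1, f (x : AddCircle (1 : ℝ))

lemma intervalIntegrable_comp_coe (g : C(AddCircle (1 : ℝ), ℂ)) :
    IntervalIntegrable (fun x : ℝ => g (x : AddCircle (1 : ℝ))) volume 0 1 :=
  (g.continuous.comp (AddCircle.continuous_mk' 1)).intervalIntegrable _ _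

lemma averageError_add (χ : ℝ) (n : ℕ) (f g : C(AddCircle (1 : ℝ), ℂ)) :
    averageError χ n (f + g) = averageError χ n f + averageError χ n g := by
  simp only [averageError, ContinuousMap.add_apply, Finset.sum_add_distrib]
  rw [intervalIntegral.integral_add (intervalIntegrable_comp_coe f)
    (intervalIntegrable_comp_coe g)]
  ring

lemma averageError_smul (χ : ℝ) (n : ℕ) (c : ℂ) (f : C(AddCircle (1 : ℝ), ℂ)) :
    averageError χ n (c • f) = c * averageError χ n f := by
  simp only [averageError, ContinuousMap.smul_apply, smul_eq_mul, ← Finset.mul_sum]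
  rw [intervalIntegral.integral_const_mul]
  ring

/-- Uniformity in n is what allows convergence to pass from trigonometric polynomials to their
closure. -/
lemma norm_averageError_le (χ : ℝ) (n : ℕ) (f : C(AddCircle (1 : ℝ), ℂ)) :
    ‖averageError χ n f‖ ≤ 2 * ‖f‖ := by
  have h1 : ‖(n : ℂ)⁻¹ * ∑ m ∈ Finset.range n, f ((m * χ : ℝ) : AddCircle (1 : ℝ))‖ ≤ ‖f‖ := by
    rcases Nat.eq_zero_or_pos n with rfl | hn
    · simp
    have hn' : (0 : ℝ) < n := by exact_mod_cast hn
    rw [norm_mul, norm_inv, Complex.norm_natCast, inv_mul_le_iff₀ hn']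
    refine (norm_sum_le _ _).trans ((Finset.sum_le_sum fun m _ => f.norm_coe_le_norm _).trans ?_)
    simp
  have h2 : ‖∫ x in (0 : ℝ)..1, f (x : AddCircle (1 : ℝ))‖ ≤ ‖f‖ := by
    simpa using intervalIntegral.norm_integral_le_of_norm_le_const (a := (0 : ℝ)) (b := 1)
      (f := fun x : ℝ => f (x : AddCircle (1 : ℝ))) (C := ‖f‖) fun x _ => f.norm_coe_le_norm _
  rw [averageError]
  linarith [norm_sub_le ((n : ℂ)⁻¹ * ∑ m ∈ Finset.range n, f ((m * χ : ℝ) : AddCircle (1 : ℝ)))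
    (∫ x in (0 : ℝ)..1, f (x : AddCircle (1 : ℝ)))]

lemma tendsto_averageError_fourier {χ : ℝ} (hχ : Irrational χ) (k : ℤ) :
    Tendsto (fun n => averageError χ n (fourier k)) atTop (𝓝 0) := by
  rcases eq_or_ne k 0 with rfl | hk
  · refine tendsto_const_nhds.congr' ?_
    filter_upwards [eventually_gt_atTop 0] with n hn
    have : (n : ℂ) ≠ 0 := by exact_mod_cast hn.ne'
    simp [averageError, this]
  have hI : ∫ x in (0 : ℝ)..1, fourier k (x : AddCircle (1 : ℝ)) = 0 := by
    have hc : (2 * Real.pi * Complex.I * k : ℂ) ≠ 0 := by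
      simp [Real.pi_ne_zero, hk]
    have := integral_exp_mul_complex (a := 0) (b := 1) hc
    simp only [fourier_coe_apply, Complex.ofReal_one, div_one]
    rw [this]
    have h1 : Complex.exp (2 * Real.pi * Complex.I * k * (1 : ℝ)) = 1 :=
      Complex.exp_eq_one_iff.2 ⟨k, by push_cast; ring⟩
    rw [h1]
    simp
  -- Irrationality of χ enters here: the orbit sums are geometric with ratio different from 1, hence
  -- bounded.
  have hw1 : Complex.exp (2 * Real.pi * Complex.I * k * χ) ≠ 1 := by
    rw [Ne, Complex.exp_eq_one_iff]
    rintro ⟨n, hn⟩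
    have h2 : (k : ℂ) * χ = n := by
      have := Complex.two_pi_I_ne_zero
      apply mul_left_cancel₀ this
      rw [← mul_assoc, hn]; ring
    have h3 : (k : ℝ) * χ = n := by exact_mod_cast h2
    exact (hχ.intCast_mul hk).ne_int n h3
  have hw : ‖Complex.exp (2 * Real.pi * Complex.I * k * χ)‖ = 1 := by
    simpa [mul_comm, mul_assoc, mul_left_comm] using Complex.norm_exp_ofReal_mul_I (2 * Real.pi * k * χ)
  refine (tendsto_average_pow hw hw1).congr fun n => ?_
  rw [averageError, hI, sub_zero]
  congr 1
  refine Finset.sum_congr rfl fun m _ => ?_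
  rw [fourier_coe_apply, ← Complex.exp_nat_mul]
  congr 1
  push_cast
  ring

lemma tendsto_averageError {χ : ℝ} (hχ : Irrational χ) (f : C(AddCircle (1 : ℝ), ℂ)) :
    Tendsto (fun n => averageError χ n f) atTop (𝓝 0) := by
  have : Fact ((0 : ℝ) < 1) := ⟨one_pos⟩
  have hspan : ∀ g ∈ Submodule.span ℂ (Set.range (@fourier 1)),
      Tendsto (fun n => averageError χ n g) atTop (𝓝 0) := by
    intro g hg
    induction hg using Submodule.span_induction with
    | mem g hg => obtain ⟨k, rfl⟩ := hg; exact tendsto_averageError_fourier hχ k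
    | zero => simp [averageError]
    | add g₁ g₂ _ _ h₁ h₂ => simpa [averageError_add] using h₁.add h₂
    | smul c g _ h => simpa [averageError_smul] using h.const_mul c
  have hmem : f ∈ closure (Submodule.span ℂ (Set.range (@fourier 1)) :
      Set C(AddCircle (1 : ℝ), ℂ)) := by
    rw [← Submodule.topologicalClosure_coe, span_fourier_closure_eq_top]; trivial
  rw [Metric.tendsto_atTop]
  intro ε hε
  -- The bound 2‖f - g‖ turns ε/4 into ε/2.
  obtain ⟨g, hg, hfg⟩ := Metric.mem_closure_iff.1 hmem (ε / 4) (by positivity)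
  obtain ⟨n₀, hn₀⟩ := Metric.tendsto_atTop.1 (hspan g hg) (ε / 2) (by positivity)
  refine ⟨n₀, fun n hn => ?_⟩
  have h1 := hn₀ n hn
  have h2 := norm_averageError_le χ n (f - g)
  rw [dist_eq_norm] at hfg
  rw [dist_zero_right] at h1 ⊢
  have h3 : averageError χ n f = averageError χ n (f - g) + averageError χ n g := by
    rw [← averageError_add, sub_add_cancel]
  rw [h3]
  linarith [norm_add_le (averageError χ n (f - g)) (averageError χ n g)]

/-- Weyl's equidistribution theorem for the multiples of an irrational number. -/
theorem tendsto_average_of_periodic {χ : ℝ} (hχ : Irrational χ) {F : ℝ → ℝ} (hF : Continuous F)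
    (hper : Function.Periodic F 1) :
    Tendsto (fun n : ℕ => (n : ℝ)⁻¹ * ∑ m ∈ Finset.range n, F (m * χ)) atTop
      (𝓝 (∫ x in (0 : ℝ)..1, F x)) := by
  have hc : Continuous (hper.lift : AddCircle (1 : ℝ) → ℝ) := continuous_coinduced_dom.2 hF
  let f : C(AddCircle (1 : ℝ), ℂ) := ⟨fun x => (hper.lift x : ℂ), by fun_prop⟩
  have hf : ∀ x : ℝ, f (x : AddCircle (1 : ℝ)) = (F x : ℂ) := fun x => by
    simp [f, Function.Periodic.lift_coe]
  have h := tendsto_averageError hχ f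
  simp only [averageError, hf, intervalIntegral.integral_ofReal] at h
  rw [tendsto_sub_nhds_zero_iff] at h
  have h2 := (Complex.continuous_re.tendsto _).comp h
  simp only [Complex.ofReal_re] at h2
  refine h2.congr fun n => ?_
  simp only [Function.comp]
  rw [← Complex.ofReal_sum, ← Complex.ofReal_natCast, ← Complex.ofReal_inv, ← Complex.ofReal_mul,
    Complex.ofReal_re]

end Weyl

end EllipticSeries

namespace EllipticSeries

open Filter Topology MeasureTheory

/-! ### Means of log|f| over horizontal segments in a zero-free strip. -/

section StripMean

lemma hasDerivAt_log_norm {g : ℝ → ℂ} {g' : ℂ} {y : ℝ} (hg : HasDerivAt g g' y) (h0 : g y ≠ 0) :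
    HasDerivAt (fun t => Real.log ‖g t‖) (g' / g y).re y := by
  have h1 := hg.norm_sq
  have hn : ‖g y‖ ^ 2 ≠ 0 := pow_ne_zero 2 (norm_ne_zero_iff.2 h0)
  have h2 := (h1.log hn).div_const 2
  have e : (fun t => Real.log (‖g t‖ ^ 2) / 2) = fun t => Real.log ‖g t‖ := by
    ext t
    rw [Real.log_pow]; push_cast; ring
  rw [e] at h2
  have e2 : 2 * inner ℝ (g y) g' / ‖g y‖ ^ 2 / 2 = (g' / g y).re := by
    rw [Complex.div_re, ← Complex.normSq_eq_norm_sq, Complex.inner]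
    simp only [Complex.mul_re, Complex.conj_re, Complex.conj_im]
    ring
  rwa [e2] at h2

/-- The mean of `log ‖f‖` over the horizontal unit segment at height `y`. -/
noncomputable def segmentMean (f : ℂ → ℂ) (y : ℝ) : ℝ :=
  ∫ x in (0 : ℝ)..1, Real.log ‖f (x + y * Complex.I)‖

variable {f : ℂ → ℂ} {a b : ℝ}

lemma continuous_log_norm_segment (hf : Differentiable ℂ f) {y : ℝ}
    (h0 : ∀ x : ℝ, f (x + y * Complex.I) ≠ 0) :
    Continuous fun x : ℝ => Real.log ‖f (x + y * Complex.I)‖ := by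
  have hc := hf.continuous
  exact Continuous.log (by fun_prop) fun x => norm_ne_zero_iff.2 (h0 x)

lemma deriv_add_one (hf : Differentiable ℂ f) {c : ℂ} (hper : ∀ v, f (v + 1) = c * f v) (v : ℂ) :
    deriv f (v + 1) = c * deriv f v := by
  rw [← deriv_comp_add_const, ← deriv_const_mul _ (hf v)]
  congr 1
  ext v
  exact hper v

/-- If `f` has no zeros in a horizontal strip and is `1`-periodic up to a constant factor,
then the means of `log ‖f‖` depend affinely on the height. -/
theorem exists_segmentMean_sub (hf : Differentiable ℂ f) {c : ℂ} (hc0 : c ≠ 0)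
    (hper : ∀ v, f (v + 1) = c * f v)
    (hne : ∀ v : ℂ, a < v.im → v.im < b → f v ≠ 0) :
    ∃ s : ℝ, ∀ y₁ ∈ Set.Ioo a b, ∀ y₂ ∈ Set.Ioo a b,
      segmentMean f y₂ - segmentMean f y₁ = s * (y₂ - y₁) := by
  -- The y-derivative of log|f(x + iy)| is Re(i f'/f), so it suffices that the integral of f'/f over
  -- a unit segment does not depend on the height.
  let D : ℂ → ℂ := fun v => deriv f v / f v
  have hdf : Differentiable ℂ (deriv f) := by
    intro v
    exact (hf.analyticAt v).deriv.differentiableAt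
  have hD : ∀ v : ℂ, a < v.im → v.im < b → DifferentiableAt ℂ D v := fun v h1 h2 =>
    (hdf v).div (hf v) (hne v h1 h2)
  have hDper : ∀ v, D (v + 1) = D v := fun v => by
    simp only [D, deriv_add_one hf hper, hper]
    exact mul_div_mul_left _ _ hc0
  have him : ∀ x y : ℝ, (x + y * Complex.I : ℂ).im = y := by intros; simp
  have hsub : ∀ {y₁ y₂ : ℝ}, y₁ ∈ Set.Ioo a b → y₂ ∈ Set.Ioo a b →
      ∀ y ∈ Set.uIcc y₁ y₂, y ∈ Set.Ioo a b := fun h1 h2 y hy =>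
    Set.OrdConnected.uIcc_subset Set.ordConnected_Ioo h1 h2 hy
  have hconst : ∀ y₁ ∈ Set.Ioo a b, ∀ y₂ ∈ Set.Ioo a b,
      ∫ x in (0 : ℝ)..1, D (x + y₁ * Complex.I) = ∫ x in (0 : ℝ)..1, D (x + y₂ * Complex.I) := by
    intro y₁ h1 y₂ h2
    have := Complex.integral_boundary_rect_eq_zero_of_differentiableOn D (y₁ * Complex.I)
      (1 + y₂ * Complex.I) (by
        intro v hv
        have : v.im ∈ Set.uIcc y₁ y₂ := by simpa using hv.2
        obtain ⟨h3, h4⟩ := hsub h1 h2 _ this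
        exact (hD v h3 h4).differentiableWithinAt)
    -- By periodicity the vertical sides cancel in Cauchy's theorem for the rectangle.
    have e : ∀ y : ℝ, D (1 + y * Complex.I) = D (y * Complex.I) := fun y => by
      rw [add_comm, hDper]
    simp [e] at this
    exact sub_eq_zero.1 this
  have hcontD : ∀ y₁ ∈ Set.Ioo a b, ∀ y₂ ∈ Set.Ioo a b,
      ContinuousOn (fun z : ℝ × ℝ => D (z.1 + z.2 * Complex.I))
        (Set.uIcc (0 : ℝ) 1 ×ˢ Set.uIcc y₁ y₂) := by
    intro y₁ h1 y₂ h2 z hz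
    obtain ⟨h3, h4⟩ := hsub h1 h2 _ hz.2
    have h5 : ContinuousAt D (z.1 + z.2 * Complex.I) :=
      (hD _ (by rw [him]; exact h3) (by rw [him]; exact h4)).continuousAt
    exact (ContinuousAt.comp (f := fun z : ℝ × ℝ => (z.1 + z.2 * Complex.I : ℂ)) h5
      (by fun_prop)).continuousWithinAt
  have hlogc : ∀ y ∈ Set.Ioo a b, IntervalIntegrable
      (fun x : ℝ => Real.log ‖f (x + y * Complex.I)‖) volume 0 1 := fun y hy =>
    (continuous_log_norm_segment hf fun x =>
      hne _ (by rw [him]; exact hy.1) (by rw [him]; exact hy.2)).intervalIntegrable _ _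
  rcases Set.eq_empty_or_nonempty (Set.Ioo a b) with he | ⟨y₀, hy₀⟩
  · exact ⟨0, by simp [he]⟩
  refine ⟨∫ x in (0 : ℝ)..1, (Complex.I * D (x + y₀ * Complex.I)).re, fun y₁ h1 y₂ h2 => ?_⟩
  have hIc : ContinuousOn (fun z : ℝ × ℝ => (Complex.I * D (z.1 + z.2 * Complex.I)).re)
      (Set.uIcc (0 : ℝ) 1 ×ˢ Set.uIcc y₁ y₂) :=
    Complex.continuous_re.comp_continuousOn (continuousOn_const.mul (hcontD y₁ h1 y₂ h2))
  have hftc : ∀ x ∈ Set.uIcc (0 : ℝ) 1,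
      Real.log ‖f (x + y₂ * Complex.I)‖ - Real.log ‖f (x + y₁ * Complex.I)‖ =
        ∫ y in y₁..y₂, (Complex.I * D (x + y * Complex.I)).re := by
    intro x hx
    rw [intervalIntegral.integral_eq_sub_of_hasDerivAt
      (f := fun y : ℝ => Real.log ‖f (x + y * Complex.I)‖)]
    · intro y hy
      obtain ⟨h3, h4⟩ := hsub h1 h2 y hy
      have hd : HasDerivAt (fun y : ℝ => f (x + y * Complex.I))
          (deriv f (x + y * Complex.I) * Complex.I) y := by
        have hl : HasDerivAt (fun y : ℝ => (x + y * Complex.I : ℂ)) Complex.I y := by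
          simpa using ((Complex.ofRealCLM.hasDerivAt (x := y)).mul_const Complex.I).const_add (x : ℂ)
        exact (hf _).hasDerivAt.comp y hl
      have := hasDerivAt_log_norm hd (hne _ (by rw [him]; exact h3) (by rw [him]; exact h4))
      rwa [mul_comm _ Complex.I, mul_div_assoc] at this
    · refine ContinuousOn.intervalIntegrable ?_
      exact hIc.comp (f := fun y : ℝ => (x, y)) (by fun_prop) fun y hy => ⟨hx, hy⟩
  have hmean : ∀ y ∈ Set.uIcc y₁ y₂, ∫ x in (0 : ℝ)..1, (Complex.I * D (x + y * Complex.I)).re =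
      ∫ x in (0 : ℝ)..1, (Complex.I * D (x + y₀ * Complex.I)).re := by
    have hint : ∀ y ∈ Set.Ioo a b, IntervalIntegrable
        (fun x : ℝ => Complex.I * D (x + y * Complex.I)) volume 0 1 := fun y hy =>
      ContinuousOn.intervalIntegrable ((continuousOn_const.mul (hcontD y hy y hy)).comp
        (f := fun x : ℝ => (x, y)) (by fun_prop) fun x hx => ⟨hx, by simp⟩)
    have hre : ∀ y ∈ Set.Ioo a b, ∫ x in (0 : ℝ)..1, (Complex.I * D (x + y * Complex.I)).re =
        (Complex.I * ∫ x in (0 : ℝ)..1, D (x + y * Complex.I)).re := fun y hy => by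
      rw [← intervalIntegral.integral_const_mul]
      exact Complex.reCLM.intervalIntegral_comp_comm (hint y hy)
    intro y hy
    rw [hre y (hsub h1 h2 y hy), hre y₀ hy₀, hconst y (hsub h1 h2 y hy) y₀ hy₀]
  rw [segmentMean, segmentMean, ← intervalIntegral.integral_sub (hlogc y₂ h2) (hlogc y₁ h1),
    intervalIntegral.integral_congr hftc, intervalIntegral_intervalIntegral_swap,
    intervalIntegral.integral_congr hmean]
  · simp [mul_comm]
  · exact (hIc.integrableOn_compact (isCompact_uIcc.prod isCompact_uIcc)).mono_set
      (Set.prod_mono Set.uIoc_subset_uIcc Set.uIoc_subset_uIcc)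

lemma periodic_log_norm {c : ℂ} (hc : ‖c‖ = 1) (hper : ∀ v, f (v + 1) = c * f v) (w : ℂ) :
    Function.Periodic (fun x : ℝ => Real.log ‖f (x + w)‖) 1 := by
  intro x
  have e : ((x + 1 : ℝ) : ℂ) + w = x + w + 1 := by push_cast; ring
  simp only [e, hper, norm_mul, hc, one_mul]

lemma integral_log_norm_eq_segmentMean {c : ℂ} (hc : ‖c‖ = 1) (hper : ∀ v, f (v + 1) = c * f v)
    (w : ℂ) : ∫ x in (0 : ℝ)..1, Real.log ‖f (x + w)‖ = segmentMean f w.im := by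
  have h := (periodic_log_norm hc hper (w.im * Complex.I)).intervalIntegral_add_eq 0 w.re
  have h2 := intervalIntegral.integral_comp_add_right (a := 0) (b := 1)
    (fun x : ℝ => Real.log ‖f (x + w.im * Complex.I)‖) w.re
  rw [zero_add] at h h2
  rw [segmentMean, h, add_comm w.re 1, ← h2]
  congr 1
  ext x
  congr 3
  apply Complex.ext <;> simp

end StripMean

end EllipticSeries

namespace EllipticSeries

open Filter Topology MeasureTheory

/-! ### The piecewise affine mean of log|`modTheta`|. -/

section ModThetaMean

variable {τ : ℂ} {N M : ℤ}

lemma ne_int_mul_of_mem_Ioo {T y : ℝ} (hT : 0 < T) {m : ℤ}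
    (hy : y ∈ Set.Ioo (m * T) ((m + 1) * T)) (n : ℤ) : y ≠ n * T := by
  rintro rfl
  have h1 : (m : ℝ) < n := lt_of_mul_lt_mul_right hy.1 hT.le
  have h2 : (n : ℝ) < m + 1 := lt_of_mul_lt_mul_right hy.2 hT.le
  norm_cast at h1 h2
  omega

lemma exists_modTheta_add_one (hτ : 0 < τ.im) (N M : ℤ) :
    ∃ c : ℂ, ‖c‖ = 1 ∧ ∀ v, modTheta τ N M (v + 1) = c * modTheta τ N M v :=
  ⟨_, Complex.norm_exp_ofReal_mul_I _, modTheta_add_one hτ⟩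

lemma integral_log_norm_modTheta (hτ : 0 < τ.im) (N M : ℤ) (w : ℂ) :
    ∫ x in (0 : ℝ)..1, Real.log ‖modTheta τ N M (x + w)‖ = segmentMean (modTheta τ N M) w.im := by
  obtain ⟨c, hc, hper⟩ := exists_modTheta_add_one hτ N M
  exact integral_log_norm_eq_segmentMean hc hper w

/-- Oddness combined with the reflection x ↦ 1 - x of the segment. -/
lemma segmentMean_modTheta_neg (hτ : 0 < τ.im) (y : ℝ) :
    segmentMean (modTheta τ N M) (-y) = segmentMean (modTheta τ N M) y := by
  obtain ⟨c, hc, hper⟩ := exists_modTheta_add_one hτ N M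
  have h := intervalIntegral.integral_comp_sub_left (a := 0) (b := 1)
    (fun x : ℝ => Real.log ‖modTheta τ N M (x + y * Complex.I)‖) 1
  rw [sub_self, sub_zero] at h
  rw [segmentMean, segmentMean, ← h]
  congr 1
  ext x
  have h2 : ((1 - x : ℝ) : ℂ) + y * Complex.I = -(x + (-y : ℝ) * Complex.I) + 1 := by
    push_cast; ring
  rw [h2, hper, norm_mul, hc, one_mul, modTheta_neg hτ, norm_neg]

/-- Bézout completes (N, M) to a basis of the lattice; τ' is the second basis vector divided by σ.
-/
lemma exists_modulus (hτ : 0 < τ.im) (hNM : IsCoprime N M) :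
    ∃ (τ' : ℂ) (K L : ℤ), N * L - M * K = 1 ∧ period τ N M * τ' = K + L * τ ∧
      τ'.im = height τ N M := by
  obtain ⟨a, b, hab⟩ := hNM
  have hKL : N * a - M * (-b) = 1 := by linear_combination hab
  have h : period τ N M * (((-b : ℤ) + (a : ℤ) * τ) / period τ N M) = (-b : ℤ) + (a : ℤ) * τ :=
    mul_div_cancel₀ _ (period_ne_zero hτ ⟨a, b, hab⟩)
  refine ⟨_, -b, a, hKL, h, ?_⟩
  rw [im_of_period_mul_eq hτ ⟨a, b, hab⟩ h, hKL]
  simp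

lemma segmentMean_modTheta_add_height (hτ : 0 < τ.im) (hNM : IsCoprime N M) {y : ℝ}
    (hy : ∀ m : ℤ, y ≠ m * height τ N M) :
    segmentMean (modTheta τ N M) (y + height τ N M) =
      segmentMean (modTheta τ N M) y + Real.pi * (height τ N M + 2 * y) := by
  obtain ⟨τ', K, L, hKL, hτ', him⟩ := exists_modulus hτ hNM
  have h0 : ∀ x : ℝ, modTheta τ N M (x + y * Complex.I) ≠ 0 := fun x =>
    modTheta_ne_zero hτ hNM (by simpa using hy)
  have hlog : ∀ x : ℝ, Real.log ‖modTheta τ N M (x + (y * Complex.I + τ'))‖ =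
      Real.log ‖modTheta τ N M (x + y * Complex.I)‖ + Real.pi * (height τ N M + 2 * y) := by
    intro x
    rw [← add_assoc, modTheta_add_modulus hτ hKL hτ', norm_mul, norm_mul,
      Complex.norm_exp_ofReal_mul_I, one_mul, Complex.norm_exp,
      Real.log_mul (Real.exp_ne_zero _) (norm_ne_zero_iff.2 (h0 x)), Real.log_exp, add_comm]
    simp [him]
  have h1 := integral_log_norm_modTheta hτ N M (y * Complex.I + τ')
  have h2 : (y * Complex.I + τ' : ℂ).im = y + height τ N M := by simp [him]
  rw [← h2, ← h1, segmentMean]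
  simp only [hlog]
  rw [intervalIntegral.integral_add
    ((continuous_log_norm_segment (differentiable_modTheta hτ) h0).intervalIntegrable _ _)
    intervalIntegrable_const]
  simp

/-- The mean of `log ‖ϑ‖` over a horizontal unit segment is piecewise affine in the height. -/
theorem exists_segmentMean_modTheta (hτ : 0 < τ.im) (hNM : IsCoprime N M) :
    ∃ c : ℝ, ∀ (m : ℤ), ∀ y ∈ Set.Ioo (m * height τ N M) ((m + 1) * height τ N M),
      segmentMean (modTheta τ N M) y =
        c + Real.pi * ((2 * m + 1) * y - m * (m + 1) * height τ N M) := by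
  have hT := height_pos hτ hNM
  set T := height τ N M with hTdef
  obtain ⟨c₁, hc₁, hper⟩ := exists_modTheta_add_one hτ N M
  obtain ⟨s, hs⟩ := exists_segmentMean_sub (a := 0) (b := T) (differentiable_modTheta hτ)
    (norm_ne_zero_iff.1 (hc₁ ▸ one_ne_zero)) hper (fun v h1 h2 =>
      modTheta_ne_zero hτ hNM (ne_int_mul_of_mem_Ioo hT (m := 0) ⟨by simpa using h1, by simpa using h2⟩))
  have hmem : ∀ y ∈ Set.Ioo 0 T, ∀ m : ℤ, y ≠ m * T := fun y hy =>
    ne_int_mul_of_mem_Ioo hT (m := 0) ⟨by simpa using hy.1, by simpa using hy.2⟩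
  -- Moving -T/3 up by T gives 2T/3. By evenness the mean thus grows by πT/3 from T/3 to 2T/3, while
  -- affinity gives sT/3.
  have hspi : s = Real.pi := by
    have h3 : T / 3 ∈ Set.Ioo 0 T := ⟨by positivity, by linarith⟩
    have h4 : -(T / 3) + T ∈ Set.Ioo 0 T := ⟨by linarith, by linarith⟩
    have h5 := hs _ h3 _ h4
    have h6 := segmentMean_modTheta_add_height hτ hNM (y := -(T / 3)) fun m hm =>
      hmem _ h3 (-m) (by push_cast; linarith)
    rw [← hTdef, segmentMean_modTheta_neg hτ] at h6
    rw [h6] at h5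
    have : T * (s - Real.pi) = 0 := by linear_combination -3 * h5
    exact sub_eq_zero.1 ((mul_eq_zero.1 this).resolve_left hT.ne')
  have hhalf : T / 2 ∈ Set.Ioo 0 T := ⟨by positivity, by linarith⟩
  refine ⟨segmentMean (modTheta τ N M) (T / 2) - Real.pi * (T / 2), ?_⟩
  set c := segmentMean (modTheta τ N M) (T / 2) - Real.pi * (T / 2) with hc
  have hnat : ∀ (m : ℕ), ∀ y ∈ Set.Ioo (m * T) ((m + 1) * T),
      segmentMean (modTheta τ N M) y = c + Real.pi * ((2 * m + 1) * y - m * (m + 1) * T) := by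
    intro m
    induction m with
    | zero =>
      intro y hy
      have hy' : y ∈ Set.Ioo 0 T := ⟨by simpa using hy.1, by simpa using hy.2⟩
      have := hs _ hhalf _ hy'
      rw [hspi] at this
      push_cast
      linarith
    | succ m ih =>
      intro y hy
      obtain ⟨h1, h2⟩ := hy
      push_cast at h1 h2 ⊢
      have hy' : y - T ∈ Set.Ioo (m * T) ((m + 1) * T) := ⟨by linarith, by linarith⟩
      have h3 := segmentMean_modTheta_add_height hτ hNM
        (ne_int_mul_of_mem_Ioo hT (m := m) (by exact_mod_cast hy'))
      rw [← hTdef, sub_add_cancel, ih _ hy'] at h3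
      rw [h3]
      ring
  intro m y hy
  -- Reflection y ↦ -y exchanges strips n and -n - 1, so evenness handles negative indices.
  obtain ⟨n, rfl | rfl⟩ : ∃ n : ℕ, m = n ∨ m = -(n : ℤ) - 1 := by
    rcases le_or_gt 0 m with h | h
    · exact ⟨m.toNat, Or.inl (by omega)⟩
    · exact ⟨(-m - 1).toNat, Or.inr (by omega)⟩
  · exact_mod_cast hnat n y (by exact_mod_cast hy)
  · obtain ⟨h1, h2⟩ := hy
    push_cast at h1 h2 ⊢
    rw [← segmentMean_modTheta_neg hτ, hnat n (-y) ⟨by linarith, by linarith⟩]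
    ring

end ModThetaMean

end EllipticSeries

namespace EllipticSeries

open Filter Topology MeasureTheory

/-! ### Coefficients, the root test and the radius of convergence. -/

section Series

variable {τ : ℂ} {N M : ℤ} {χ : ℝ}

lemma theta_exp_eq (τ : ℂ) (N M : ℤ) (v : ℂ) :
    theta (Complex.exp (2 * Real.pi * Complex.I * (period τ N M * v))) (base τ) =
      Complex.exp (-(Real.pi * Complex.I * (M * period τ N M * v ^ 2 - period τ N M * v))) *
        modTheta τ N M v := by
  have e : Complex.exp (-(Real.pi * Complex.I * (M * period τ N M * v ^ 2 - period τ N M * v))) *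
      (Complex.exp (Real.pi * Complex.I * (M * period τ N M * v ^ 2)) *
        Complex.exp (-(Real.pi * Complex.I * (period τ N M * v)))) = 1 := by
    rw [← Complex.exp_add, ← Complex.exp_add, Complex.exp_eq_one_iff]
    exact ⟨0, by push_cast; ring⟩
  rw [modTheta, oddTheta]
  linear_combination -theta (Complex.exp (2 * Real.pi * Complex.I * (period τ N M * v)))
    (base τ) * e

/-- The additive coordinate of `param τ N M χ h φ`. -/
noncomputable def paramArg (τ : ℂ) (N M : ℤ) (χ h φ : ℝ) : ℂ :=
  (χ * h : ℝ) - (φ * height τ N M : ℝ) * Complex.I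

lemma paramArg_im (τ : ℂ) (N M : ℤ) (χ h φ : ℝ) :
    (paramArg τ N M χ h φ).im = -(φ * height τ N M) := by
  simp [paramArg]

lemma param_eq_exp (hτ : 0 < τ.im) (hNM : IsCoprime N M) (χ h φ : ℝ) :
    param τ N M χ h φ =
      Complex.exp (2 * Real.pi * Complex.I * (period τ N M * paramArg τ N M χ h φ)) := by
  have hp := period_ne_zero hτ hNM
  have hc : (N + M * (starRingEnd ℂ) τ : ℂ) = (starRingEnd ℂ) (period τ N M) := by
    simp [period]
  have hc0 : (starRingEnd ℂ) (period τ N M) ≠ 0 := by simpa using hp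
  have hh : (height τ N M : ℂ) = τ.im / (period τ N M * (starRingEnd ℂ) (period τ N M)) := by
    rw [height, Complex.mul_conj, Complex.normSq_eq_norm_sq]
    push_cast
    rfl
  have e : (2 * Real.pi * τ.im / (N + M * (starRingEnd ℂ) τ) : ℂ) =
      2 * Real.pi * (period τ N M * height τ N M) := by
    rw [hc, hh]
    field_simp
  rw [param, qPow, e, ← Complex.exp_add, paramArg]
  congr 1
  rw [← period]
  push_cast
  linear_combination (2 * Real.pi * (period τ N M * height τ N M) * φ) * Complex.I_sq

lemma qPow_one_pow (τ : ℂ) (N M : ℤ) (χ : ℝ) (m : ℕ) :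
    qPow τ N M χ 1 ^ m =
      Complex.exp (2 * Real.pi * Complex.I * (period τ N M * (m * χ : ℝ))) := by
  rw [qPow, ← Complex.exp_nat_mul, period]
  congr 1
  push_cast
  ring

lemma exp_mul_qPow_one_pow (τ : ℂ) (N M : ℤ) (χ : ℝ) (v : ℂ) (m : ℕ) :
    Complex.exp (2 * Real.pi * Complex.I * (period τ N M * v)) * qPow τ N M χ 1 ^ m =
      Complex.exp (2 * Real.pi * Complex.I * (period τ N M * ((m * χ : ℝ) + v))) := by
  rw [qPow_one_pow, ← Complex.exp_add]
  ring_nf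

lemma ellPoch_exp_ne_zero (hτ : 0 < τ.im) (hNM : IsCoprime N M) {v : ℂ}
    (hv : ∀ m : ℤ, v.im ≠ m * height τ N M) (n : ℕ) :
    ellPoch (Complex.exp (2 * Real.pi * Complex.I * (period τ N M * v))) (base τ)
      (qPow τ N M χ 1) n ≠ 0 := by
  refine Finset.prod_ne_zero_iff.2 fun m _ => ?_
  rw [exp_mul_qPow_one_pow, theta_exp_eq]
  exact mul_ne_zero (Complex.exp_ne_zero _) (modTheta_ne_zero hτ hNM (by simpa using hv))

/-- A zero would put (m + 1)χσ in ℤ + ℤτ, making (m + 1)χM and (m + 1)χN integers. As M and N are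
not both zero, χ would be rational. -/
lemma ellPoch_qPow_one_ne_zero (hτ : 0 < τ.im) (hNM : IsCoprime N M) (hχ : Irrational χ) (n : ℕ) :
    ellPoch (qPow τ N M χ 1) (base τ) (qPow τ N M χ 1) n ≠ 0 := by
  refine Finset.prod_ne_zero_iff.2 fun m _ => ?_
  rw [← pow_succ', qPow_one_pow]
  refine theta_ne_zero (norm_base_lt_one hτ) (Complex.exp_ne_zero _) fun k hk => ?_
  rw [base, ← Complex.exp_int_mul, Complex.exp_eq_exp_iff_exists_int] at hk
  obtain ⟨a, ha⟩ := hk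
  have h1 : period τ N M * (((m + 1 : ℕ) : ℝ) * χ : ℝ) = a + k * τ := by
    refine mul_left_cancel₀ Complex.two_pi_I_ne_zero ?_
    rw [ha]
    ring
  have him := congrArg Complex.im h1
  have hre := congrArg Complex.re h1
  simp only [period, Complex.mul_re, Complex.mul_im, Complex.add_re, Complex.add_im,
    Complex.intCast_re, Complex.intCast_im, Complex.ofReal_re, Complex.ofReal_im] at him hre
  have hk : (((M * (m + 1 : ℕ) : ℤ) : ℝ) * χ) = k := by
    push_cast at him ⊢
    refine mul_right_cancel₀ hτ.ne' ?_
    linear_combination him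
  have ha : (((N * (m + 1 : ℕ) : ℤ) : ℝ) * χ) = a := by
    push_cast at hk hre ⊢
    linear_combination hre - τ.re * hk
  have hm : ((m + 1 : ℕ) : ℤ) ≠ 0 := by positivity
  by_cases hM : M = 0
  · have hN : N ≠ 0 := by
      rintro rfl
      exact not_isUnit_zero (isCoprime_zero_left.1 (hM ▸ hNM))
    exact (hχ.intCast_mul (mul_ne_zero hN hm)).ne_int a ha
  · exact (hχ.intCast_mul (mul_ne_zero hM hm)).ne_int k hk

lemma exp_ne_qPow_mul_base_zpow (hτ : 0 < τ.im) (hNM : IsCoprime N M) {v : ℂ}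
    (hv : ∀ m : ℤ, v.im ≠ m * height τ N M) (x : ℝ) (m : ℤ) :
    Complex.exp (2 * Real.pi * Complex.I * (period τ N M * v)) ≠
      qPow τ N M χ x * base τ ^ m := by
  intro h
  rw [qPow, base, ← Complex.exp_int_mul, ← Complex.exp_add,
    Complex.exp_eq_exp_iff_exists_int] at h
  obtain ⟨a, ha⟩ := h
  have h1 : period τ N M * (v - (χ * x : ℝ)) = a + m * τ := by
    refine mul_left_cancel₀ Complex.two_pi_I_ne_zero ?_
    rw [mul_sub, mul_sub, ha, period]
    push_cast
    ring
  refine hv (N * m - M * a) ?_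
  rw [← im_of_period_mul_eq hτ hNM h1]
  simp

/-- The root test: the radius of convergence in terms of the exponential growth rate of the
coefficients. -/
lemma radius_ofScalars_eq_of_tendsto_log {c : ℕ → ℂ} (hc : ∀ n, c n ≠ 0) {l : ℝ}
    (h : Tendsto (fun n : ℕ => (n : ℝ)⁻¹ * Real.log ‖c n‖) atTop (𝓝 l)) :
    (FormalMultilinearSeries.ofScalars ℂ c).radius = ENNReal.ofReal (Real.exp (-l)) := by
  rw [FormalMultilinearSeries.radius_eq_liminf]
  refine Tendsto.liminf_eq ?_
  have h1 : Tendsto (fun n : ℕ => ENNReal.ofReal (Real.exp (-((n : ℝ)⁻¹ * Real.log ‖c n‖)))) atTop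
      (𝓝 (ENNReal.ofReal (Real.exp (-l)))) :=
    ENNReal.tendsto_ofReal ((Real.continuous_exp.tendsto _).comp h.neg)
  refine h1.congr fun n => ?_
  rw [← ENNReal.ofReal_coe_nnreal]
  push_cast
  rw [FormalMultilinearSeries.ofScalars_norm, Real.rpow_def_of_pos (norm_pos_iff.2 (hc n)),
    Real.exp_neg, one_div, one_div, mul_comm, ENNReal.ofReal_inv_of_pos (Real.exp_pos _)]

variable {r : ℕ}

/-- With v' = S - v, the quadratic exponents differ by a multiple of v' - v independent of j; by
balancing these differences sum to zero. -/
lemma prod_theta_div_eq (τ : ℂ) (N M : ℤ) {v v' : Fin r → ℂ} (hsum : ∑ j, v' j = ∑ j, v j)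
    (hwp : ∀ i j, v' i + v i = v' j + v j) (x : ℂ) :
    ∏ j, (theta (Complex.exp (2 * Real.pi * Complex.I * (period τ N M * (x + v j)))) (base τ) /
      theta (Complex.exp (2 * Real.pi * Complex.I * (period τ N M * (x + v' j)))) (base τ)) =
    ∏ j, (modTheta τ N M (x + v j) / modTheta τ N M (x + v' j)) := by
  have hS : ∃ S, ∀ j, v' j = S - v j := by
    rcases isEmpty_or_nonempty (Fin r) with h | ⟨⟨j₀⟩⟩
    · exact ⟨0, fun j => h.elim j⟩
    · exact ⟨v' j₀ + v j₀, fun j => by rw [← hwp j j₀]; ring⟩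
  obtain ⟨S, hS⟩ := hS
  have hsub : ∑ j, (v' j - v j) = 0 := by rw [Finset.sum_sub_distrib, hsum, sub_self]
  have hexp : ∏ j, Complex.exp (Real.pi * Complex.I * period τ N M *
      ((M * (2 * x + S) - 1) * (v' j - v j))) = 1 := by
    rw [← Complex.exp_sum, ← Finset.mul_sum, ← Finset.mul_sum, hsub]
    simp
  rw [← one_mul (∏ j, (modTheta τ N M (x + v j) / _)), ← hexp, ← Finset.prod_mul_distrib]
  refine Finset.prod_congr rfl fun j _ => ?_
  rw [theta_exp_eq, theta_exp_eq, mul_div_mul_comm, ← Complex.exp_sub, hS j]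
  congr 2
  ring

/-- The radius of convergence of a well-poised balanced series with `t_0 = q`, in terms of the means
of `log ‖ϑ‖` over horizontal segments. -/
theorem radiusE_eq (hτ : 0 < τ.im) (hNM : IsCoprime N M) (hχ : Irrational χ) {v v' : Fin r → ℂ}
    (hv : ∀ j, ∀ m : ℤ, (v j).im ≠ m * height τ N M)
    (hv' : ∀ j, ∀ m : ℤ, (v' j).im ≠ m * height τ N M)
    (hsum : ∑ j, v' j = ∑ j, v j) (hwp : ∀ i j, v' i + v i = v' j + v j) :
    radiusE (Fin.cons (qPow τ N M χ 1)
        (fun j => Complex.exp (2 * Real.pi * Complex.I * (period τ N M * v j))) : Fin (r + 1) → ℂ)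
      (fun j => Complex.exp (2 * Real.pi * Complex.I * (period τ N M * v' j)))
      (qPow τ N M χ 1) (base τ) =
    ENNReal.ofReal (Real.exp (-∑ j, (segmentMean (modTheta τ N M) (v j).im -
      segmentMean (modTheta τ N M) (v' j).im))) := by
  let F : ℝ → ℝ := fun x => ∑ j, (Real.log ‖modTheta τ N M (x + v j)‖ -
    Real.log ‖modTheta τ N M (x + v' j)‖)
  have h0 : ∀ (w : ℂ), (∀ m : ℤ, w.im ≠ m * height τ N M) → ∀ x : ℝ,
      modTheta τ N M (x + w) ≠ 0 := fun w hw x =>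
    modTheta_ne_zero hτ hNM (by simpa using hw)
  have hcont : ∀ (w : ℂ), (∀ m : ℤ, w.im ≠ m * height τ N M) →
      Continuous fun x : ℝ => Real.log ‖modTheta τ N M (x + w)‖ := fun w hw => by
    have hc := (differentiable_modTheta (N := N) (M := M) hτ).continuous
    exact Continuous.log (by fun_prop) fun x => norm_ne_zero_iff.2 (h0 w hw x)
  have hF : Continuous F := continuous_finsetSum _ fun j _ =>
    (hcont _ (hv j)).sub (hcont _ (hv' j))
  obtain ⟨c, hc, hper⟩ := exists_modTheta_add_one hτ N M
  have hFper : Function.Periodic F 1 := fun x => Finset.sum_congr rfl fun j _ => by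
    have h1 := periodic_log_norm hc hper (v j) x
    have h2 := periodic_log_norm hc hper (v' j) x
    simp only at h1 h2
    rw [h1, h2]
  have hint : ∫ x in (0 : ℝ)..1, F x = ∑ j, (segmentMean (modTheta τ N M) (v j).im -
      segmentMean (modTheta τ N M) (v' j).im) := by
    simp only [F]
    rw [intervalIntegral.integral_finsetSum fun j _ =>
      ((hcont _ (hv j)).intervalIntegrable _ _).sub ((hcont _ (hv' j)).intervalIntegrable _ _)]
    refine Finset.sum_congr rfl fun j _ => ?_
    rw [intervalIntegral.integral_sub ((hcont _ (hv j)).intervalIntegrable _ _)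
      ((hcont _ (hv' j)).intervalIntegrable _ _), integral_log_norm_modTheta hτ,
      integral_log_norm_modTheta hτ]
  have hcoeff : ∀ n, coeffE (Fin.cons (qPow τ N M χ 1)
      (fun j => Complex.exp (2 * Real.pi * Complex.I * (period τ N M * v j))) : Fin (r + 1) → ℂ)
      (fun j => Complex.exp (2 * Real.pi * Complex.I * (period τ N M * v' j)))
      (qPow τ N M χ 1) (base τ) n =
      ∏ m ∈ Finset.range n, ∏ j, (modTheta τ N M ((m * χ : ℝ) + v j) /
        modTheta τ N M ((m * χ : ℝ) + v' j)) := by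
    intro n
    rw [coeffE, coeffDenom, Fin.prod_univ_succ, Fin.cons_zero,
      mul_div_mul_left _ _ (ellPoch_qPow_one_ne_zero hτ hNM hχ n), ← Finset.prod_div_distrib]
    simp only [Fin.cons_succ, ellPoch, ← Finset.prod_div_distrib]
    -- The cancellation needs all j at the same m.
    rw [Finset.prod_comm]
    refine Finset.prod_congr rfl fun m _ => ?_
    simp only [exp_mul_qPow_one_pow]
    exact prod_theta_div_eq τ N M hsum hwp _
  have hfac : ∀ m : ℕ, ∀ j, modTheta τ N M ((m * χ : ℝ) + v j) /
      modTheta τ N M ((m * χ : ℝ) + v' j) ≠ 0 := fun m j =>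
    div_ne_zero (h0 _ (hv j) _) (h0 _ (hv' j) _)
  rw [radiusE, ← hint]
  refine radius_ofScalars_eq_of_tendsto_log (fun n => ?_) ?_
  · rw [hcoeff]
    exact Finset.prod_ne_zero_iff.2 fun m _ => Finset.prod_ne_zero_iff.2 fun j _ => hfac m j
  · refine (tendsto_average_of_periodic hχ hF hFper).congr fun n => ?_
    rw [hcoeff, norm_prod, Real.log_prod fun m _ => norm_ne_zero_iff.2
      (Finset.prod_ne_zero_iff.2 fun j _ => hfac m j)]
    congr 1
    refine Finset.sum_congr rfl fun m _ => ?_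
    rw [norm_prod, Real.log_prod fun j _ => norm_ne_zero_iff.2 (hfac m j)]
    refine Finset.sum_congr rfl fun j _ => ?_
    rw [norm_div, Real.log_div (norm_ne_zero_iff.2 (h0 _ (hv j) _))
      (norm_ne_zero_iff.2 (h0 _ (hv' j) _))]

end Series

end EllipticSeries

namespace EllipticSeries

open Filter Topology

/-! ### From the exponents φ, h to the series parameters. -/

section Parameters

variable {τ : ℂ} {N M : ℤ} {χ : ℝ} {r : ℕ}

lemma paramArg_im_ne (hτ : 0 < τ.im) (hNM : IsCoprime N M) (χ h : ℝ) {φ : ℝ}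
    (hφ : ∀ m : ℤ, φ ≠ m) (m : ℤ) : (paramArg τ N M χ h φ).im ≠ m * height τ N M := by
  rw [paramArg_im]
  intro h1
  have h2 : φ * height τ N M = (-m : ℝ) * height τ N M := by linarith
  exact hφ (-m) (by simpa using mul_right_cancel₀ (height_pos hτ hNM).ne' h2)

lemma paramArg_add (τ : ℂ) (N M : ℤ) (χ h h' φ φ' : ℝ) :
    paramArg τ N M χ h' φ' + paramArg τ N M χ h φ = paramArg τ N M χ (h' + h) (φ' + φ) := by
  simp only [paramArg]
  push_cast
  ring

lemma sum_paramArg (τ : ℂ) (N M : ℤ) (χ : ℝ) (h φ : Fin r → ℝ) :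
    ∑ j, paramArg τ N M χ (h j) (φ j) = paramArg τ N M χ (∑ j, h j) (∑ j, φ j) := by
  simp only [paramArg, Finset.sum_sub_distrib, ← Finset.sum_mul, ← Complex.ofReal_sum,
    Finset.mul_sum]

lemma isWellPoisedBalanced_param (hτ : 0 < τ.im) (hNM : IsCoprime N M) (hχ : Irrational χ)
    {h h' φ φ' : Fin r → ℝ} (hφ : ∀ j, ∀ m : ℤ, φ j ≠ m) (hφ' : ∀ j, ∀ m : ℤ, φ' j ≠ m)
    (hφs : ∀ i j, φ' i + φ i = φ' j + φ j) (hhs : ∀ i j, h' i + h i = h' j + h j)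
    (hφt : ∑ j, φ' j = ∑ j, φ j) (hht : ∑ j, h' j = ∑ j, h j) :
    IsWellPoisedBalanced
      (Fin.cons (qPow τ N M χ 1) fun j => param τ N M χ (h j) (φ j))
      (fun j => param τ N M χ (h' j) (φ' j)) (qPow τ N M χ 1) (base τ) := by
  simp only [param_eq_exp hτ hNM]
  refine ⟨rfl, fun n => ?_, fun n => ?_, ?_, fun i j => ?_⟩
  · rw [Fin.prod_univ_succ]
    refine mul_ne_zero (ellPoch_qPow_one_ne_zero hτ hNM hχ n)
      (Finset.prod_ne_zero_iff.2 fun j _ => ?_)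
    exact ellPoch_exp_ne_zero hτ hNM (paramArg_im_ne hτ hNM χ _ (hφ j)) n
  · refine mul_ne_zero (ellPoch_qPow_one_ne_zero hτ hNM hχ n)
      (Finset.prod_ne_zero_iff.2 fun j _ => ?_)
    exact ellPoch_exp_ne_zero hτ hNM (paramArg_im_ne hτ hNM χ _ (hφ' j)) n
  · rw [Fin.prod_univ_succ]
    simp only [Fin.cons_zero, Fin.cons_succ, ← Complex.exp_sum, ← Finset.mul_sum, sum_paramArg,
      hφt, hht]
  · simp only [Fin.cons_succ, ← Complex.exp_add, ← mul_add]
    rw [add_comm, add_comm (paramArg τ N M χ (h j) _), paramArg_add, paramArg_add, hφs i j, hhs i j]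

lemma offLine_param (hτ : 0 < τ.im) (hNM : IsCoprime N M) (χ : ℝ)
    {h h' φ φ' : Fin r → ℝ} (hφ : ∀ j, ∀ m : ℤ, φ j ≠ m) (hφ' : ∀ j, ∀ m : ℤ, φ' j ≠ m) :
    OffLine τ N M χ (fun j => param τ N M χ (h j) (φ j))
      (fun j => param τ N M χ (h' j) (φ' j)) := by
  intro j x m
  simp only [param_eq_exp hτ hNM]
  exact ⟨exp_ne_qPow_mul_base_zpow hτ hNM (paramArg_im_ne hτ hNM χ _ (hφ j)) x m,
    exp_ne_qPow_mul_base_zpow hτ hNM (paramArg_im_ne hτ hNM χ _ (hφ' j)) x m⟩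

/-- The radius of convergence in terms of the floors `m j`, `m' j` of `φ j`, `φ' j`. -/
theorem radiusE_param (hτ : 0 < τ.im) (hNM : IsCoprime N M) (hχ : Irrational χ)
    {h h' φ φ' : Fin r → ℝ} {m m' : Fin r → ℤ}
    (hφ : ∀ j, φ j ∈ Set.Ioo (m j : ℝ) (m j + 1)) (hφ' : ∀ j, φ' j ∈ Set.Ioo (m' j : ℝ) (m' j + 1))
    (hφs : ∀ i j, φ' i + φ i = φ' j + φ j) (hhs : ∀ i j, h' i + h i = h' j + h j)
    (hφt : ∑ j, φ' j = ∑ j, φ j) (hht : ∑ j, h' j = ∑ j, h j) :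
    radiusE (Fin.cons (qPow τ N M χ 1) fun j => param τ N M χ (h j) (φ j) : Fin (r + 1) → ℂ)
      (fun j => param τ N M χ (h' j) (φ' j)) (qPow τ N M χ 1) (base τ) =
    ENNReal.ofReal (Real.exp (-(Real.pi * height τ N M *
      ∑ j, (((2 * m j + 1) * φ j - m j * (m j + 1)) -
        ((2 * m' j + 1) * φ' j - m' j * (m' j + 1)))))) := by
  have hT := height_pos hτ hNM
  have hne : ∀ {x : ℝ} {n : ℤ}, x ∈ Set.Ioo (n : ℝ) (n + 1) → ∀ m : ℤ, x ≠ m := by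
    rintro x n ⟨h1, h2⟩ m rfl
    norm_cast at h1 h2
    omega
  obtain ⟨c, hc⟩ := exists_segmentMean_modTheta hτ hNM
  have hmean : ∀ (h x : ℝ) (n : ℤ), x ∈ Set.Ioo (n : ℝ) (n + 1) →
      segmentMean (modTheta τ N M) (paramArg τ N M χ h x).im =
        c + Real.pi * height τ N M * ((2 * n + 1) * x - n * (n + 1)) := by
    intro h x n hx
    -- Evenness absorbs the sign in Im v = -φT; the constant `c` later cancels between numerator and
    -- denominator.
    rw [paramArg_im, segmentMean_modTheta_neg hτ, hc n _
      ⟨mul_lt_mul_of_pos_right hx.1 hT, mul_lt_mul_of_pos_right hx.2 hT⟩]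
    ring
  simp only [param_eq_exp hτ hNM]
  rw [radiusE_eq hτ hNM hχ (fun j => paramArg_im_ne hτ hNM χ _ (hne (hφ j)))
    (fun j => paramArg_im_ne hτ hNM χ _ (hne (hφ' j)))
    (by rw [sum_paramArg, sum_paramArg, hφt, hht])
    (fun i j => by rw [paramArg_add, paramArg_add, hφs i j, hhs i j])]
  congr 3
  rw [Finset.mul_sum]
  refine Finset.sum_congr rfl fun j _ => ?_
  rw [hmean _ _ _ (hφ j), hmean _ _ _ (hφ' j)]
  ring

lemma sum_ite_val_eq_zero (hr : 0 < r) (A B : ℝ) :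
    ∑ j : Fin r, (if (j : ℕ) = 0 then A else B) = A + (r - 1) * B := by
  obtain ⟨n, rfl⟩ := Nat.exists_eq_succ_of_ne_zero hr.ne'
  rw [Fin.sum_univ_succ]
  simp

end Parameters

/-! ### The special exponents and the sign of log r_c⁻¹. -/

section Main

variable {τ : ℂ} {N M : ℤ} {χ : ℝ} {r : ℕ}

lemma eq_of_add_const_of_sum_eq (hr : 2 < r) {ε : ℝ} {φ φ' : Fin r → ℝ}
    (hφ : ∀ j : Fin r, φ j = if (j : ℕ) = 0 then 1 + ε * r / 2 else 1 - ε)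
    (hφs : ∀ i j : Fin r, φ' i + φ i = φ' j + φ j) (hφt : ∑ j, φ' j = ∑ j, φ j) (j : Fin r) :
    φ' j = if (j : ℕ) = 0 then 1 - ε * (1 - 2 / (r : ℝ) + (r : ℝ) / 2) else 1 + 2 * ε / r := by
  have hr0 : (r : ℝ) ≠ 0 := by positivity
  -- Since both families have equal sums, this determines the common value of φ' + φ as 2Σφ/r.
  have h1 : ∑ i : Fin r, (φ' i + φ i) = r * (φ' j + φ j) := by
    rw [Finset.sum_congr rfl fun i _ => hφs i j]
    simp [mul_add]
  have h2 : ∑ i, φ i = 1 + ε * r / 2 + (r - 1) * (1 - ε) := by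
    rw [← sum_ite_val_eq_zero (by omega)]
    exact Finset.sum_congr rfl fun i _ => hφ i
  rw [Finset.sum_add_distrib, hφt, h2] at h1
  have h3 : φ' j = 2 * (1 + ε * r / 2 + (r - 1) * (1 - ε)) / r - φ j := by
    field_simp
    linarith
  rw [h3, hφ j]
  split_ifs <;> field_simp <;> ring

end Main

end EllipticSeries

namespace EllipticSeries

section Main

variable {τ : ℂ} {N M : ℤ} {χ : ℝ} {r : ℕ}

/-- The series with the special exponents `φ`, `φ'`: the exponents are non-integral, and the radius
of convergence is explicit. -/
theorem radiusE_special (hτ : 0 < τ.im) (hNM : IsCoprime N M) (hχ : Irrational χ) (hr : 2 < r)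
    {k : ℕ} {lam ε : ℝ} {h h' φ φ' : Fin r → ℝ} (hk : (k : ℝ) + 1 ≤ (r : ℝ) / 2)
    (hl0 : 0 < lam) (hl1 : lam < 1 - 2 / (r : ℝ)) (hε : ε = ((k : ℝ) + 1) / ((r : ℝ) / 2 + lam))
    (hφ : ∀ j : Fin r, φ j = if (j : ℕ) = 0 then 1 + ε * r / 2 else 1 - ε)
    (hφ' : ∀ j : Fin r, φ' j =
      if (j : ℕ) = 0 then 1 - ε * (1 - 2 / (r : ℝ) + (r : ℝ) / 2) else 1 + 2 * ε / r)
    (hφs : ∀ i j, φ' i + φ i = φ' j + φ j) (hhs : ∀ i j, h' i + h i = h' j + h j)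
    (hφt : ∑ j, φ' j = ∑ j, φ j) (hht : ∑ j, h' j = ∑ j, h j) :
    (∀ j, ∀ m : ℤ, φ j ≠ m) ∧ (∀ j, ∀ m : ℤ, φ' j ≠ m) ∧
    radiusE (Fin.cons (qPow τ N M χ 1) fun j => param τ N M χ (h j) (φ j) : Fin (r + 1) → ℂ)
      (fun j => param τ N M χ (h' j) (φ' j)) (qPow τ N M χ 1) (base τ) =
    ENNReal.ofReal (Real.exp (-(ε * Real.pi * τ.im / ‖(N : ℂ) + M * τ‖ ^ 2 *
          (2 * lam + (2 / (r : ℝ) - 1) * (2 * k + 4 - r))))) := by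
  have hr0 : (2 : ℝ) < r := by exact_mod_cast hr
  have hrpos : (0 : ℝ) < r := by linarith
  have hD : (0 : ℝ) < (r : ℝ) / 2 + lam := by positivity
  have hεD : ε * ((r : ℝ) / 2 + lam) = k + 1 := by rw [hε]; field_simp
  have hε0 : 0 < ε := by rw [hε]; positivity
  have hε1 : ε < 1 := by
    rw [hε, div_lt_one hD]
    linarith
  have h2r : 0 < 2 / (r : ℝ) := by positivity
  have h2r1 : 2 / (r : ℝ) < 1 := (div_lt_one hrpos).2 hr0
  have hel0 : 0 < ε * lam := by positivity
  have hel1 : ε * lam < 1 := by nlinarith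
  have her0 : 0 < ε * (2 / r) := by positivity
  have her1 : ε * (2 / r) < 1 := by nlinarith
  have heg0 : 0 < ε * (1 - 2 / r - lam) := mul_pos hε0 (by linarith)
  have heg1 : ε * (1 - 2 / r - lam) < 1 := by nlinarith
  have e1 : 1 + ε * r / 2 = k + 2 - ε * lam := by linear_combination hεD
  have e2 : 1 - ε * (1 - 2 / (r : ℝ) + (r : ℝ) / 2) = -k - ε * (1 - 2 / r - lam) := by
    linear_combination -hεD
  have e3 : 1 + 2 * ε / r = 1 + ε * (2 / r) := by ring
  -- Floors read off from `e1`, `e2`, `e3`: ελ, 2ε/r and ε(1 - 2/r - λ) all lie in (0, 1). The bound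
  -- λ < 1 - 2/r keeps the last one positive.
  let m : Fin r → ℤ := fun j => if (j : ℕ) = 0 then k + 1 else 0
  let m' : Fin r → ℤ := fun j => if (j : ℕ) = 0 then -k - 1 else 1
  have hm : ∀ j, φ j ∈ Set.Ioo (m j : ℝ) (m j + 1) := by
    intro j
    rw [hφ j]
    by_cases hj : (j : ℕ) = 0
    · simp only [m, if_pos hj, e1]
      push_cast
      exact ⟨by linarith, by linarith⟩
    · simp only [m, if_neg hj]
      push_cast
      exact ⟨by linarith, by linarith⟩
  have hm' : ∀ j, φ' j ∈ Set.Ioo (m' j : ℝ) (m' j + 1) := by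
    intro j
    rw [hφ' j]
    by_cases hj : (j : ℕ) = 0
    · simp only [m', if_pos hj, e2]
      push_cast
      exact ⟨by linarith, by linarith⟩
    · simp only [m', if_neg hj, e3]
      push_cast
      exact ⟨by linarith, by linarith⟩
  have hne : ∀ {x : ℝ} {n : ℤ}, x ∈ Set.Ioo (n : ℝ) (n + 1) → ∀ m : ℤ, x ≠ m := by
    rintro x n ⟨h1, h2⟩ m rfl
    norm_cast at h1 h2
    omega
  refine ⟨fun j => hne (hm j), fun j => hne (hm' j), ?_⟩
  have hterm : ∀ j : Fin r, ((2 * m j + 1) * φ j - m j * (m j + 1)) -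
      ((2 * m' j + 1) * φ' j - m' j * (m' j + 1)) =
      if (j : ℕ) = 0 then
        ((2 * k + 3) * (1 + ε * r / 2) - (k + 1) * (k + 2)) -
          (-(2 * k + 1) * (1 - ε * (1 - 2 / (r : ℝ) + (r : ℝ) / 2)) - k * (k + 1))
      else (1 - ε) - (3 * (1 + 2 * ε / r) - 2) := by
    intro j
    rw [hφ j, hφ' j]
    by_cases hj : (j : ℕ) = 0
    · simp only [m, m', if_pos hj]
      push_cast
      ring
    · simp only [m, m', if_neg hj]
      push_cast
      ring
  rw [radiusE_param hτ hNM hχ hm hm' hφs hhs hφt hht]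
  congr 3
  have hri : (r : ℝ) * (r : ℝ)⁻¹ = 1 := mul_inv_cancel₀ hrpos.ne'
  have key : ∑ j, (((2 * m j + 1) * φ j - m j * (m j + 1)) -
      ((2 * m' j + 1) * φ' j - m' j * (m' j + 1))) =
      ε * (2 * lam + (2 / (r : ℝ) - 1) * (2 * k + 4 - r)) := by
    rw [Finset.sum_congr rfl fun j _ => hterm j, sum_ite_val_eq_zero (by omega)]
    linear_combination (-2 : ℝ) * hεD - 4 * ε * hri
  rw [key, height, period]
  ring

/-- The factor 2k + 4 - r is 2 for even r but only 1 for odd r, hence the stronger bound on λ in the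
odd case. -/
lemma factor_neg (hr : 2 < r) {k : ℕ} {lam : ℝ} (hl1 : lam < 1 - 2 / (r : ℝ))
    (hk : k = (r - 2) / 2) (hpar : Even r ∨ (Odd r ∧ 2 * lam < 1 - 2 / (r : ℝ))) :
    2 * lam + (2 / (r : ℝ) - 1) * (2 * k + 4 - r) < 0 := by
  rcases hpar with ⟨s, hs⟩ | ⟨⟨s, hs⟩, hl⟩
  · have : 2 * k + 2 = r := by omega
    have : (2 * k + 2 : ℝ) = r := by exact_mod_cast this
    rw [show (2 * k + 4 - r : ℝ) = 2 by linarith]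
    linarith
  · have : 2 * k + 3 = r := by omega
    have : (2 * k + 3 : ℝ) = r := by exact_mod_cast this
    rw [show (2 * k + 4 - r : ℝ) = 1 by linarith]
    linarith

end Main

end EllipticSeries

theorem mainTheorem7 (τ : ℂ) (hτ : 0 < τ.im) (N M : ℤ) (hNM : IsCoprime N M)
    (χ : ℝ) (hχ : Irrational χ) (r : ℕ) (hr : 2 < r) :
    (∀ (k : ℕ) (lam ε : ℝ) (h h' φ φ' : Fin r → ℝ),
      ((k : ℝ) + 1 ≤ (r : ℝ) / 2) →
      0 < lam → lam < 1 - 2 / (r : ℝ) →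
      ε = ((k : ℝ) + 1) / ((r : ℝ) / 2 + lam) →
      (∀ j : Fin r, φ j = if (j : ℕ) = 0 then 1 + ε * r / 2 else 1 - ε) →
      (∀ i j : Fin r, φ' i + φ i = φ' j + φ j) →
      (∀ i j : Fin r, h' i + h i = h' j + h j) →
      ∑ j, φ' j = ∑ j, φ j →
      ∑ j, h' j = ∑ j, h j →
      let p : ℂ := EllipticSeries.base τ
      let q : ℂ := EllipticSeries.qPow τ N M χ 1
      let t : Fin r → ℂ := fun j => EllipticSeries.param τ N M χ (h j) (φ j)
      let w : Fin r → ℂ := fun j => EllipticSeries.param τ N M χ (h' j) (φ' j)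
      (∀ j : Fin r, φ' j =
        if (j : ℕ) = 0 then 1 - ε * (1 - 2 / (r : ℝ) + (r : ℝ) / 2) else 1 + 2 * ε / r) ∧
      EllipticSeries.IsWellPoisedBalanced (Fin.cons q t) w q p ∧
      EllipticSeries.OffLine τ N M χ t w ∧
      ∃ rc : ℝ, 0 < rc ∧
        EllipticSeries.radiusE (Fin.cons q t : Fin (r + 1) → ℂ) w q p = ENNReal.ofReal rc ∧
        Real.log rc⁻¹ = ε * Real.pi * τ.im / ‖(N : ℂ) + M * τ‖ ^ 2 *
          (2 * lam + (2 / (r : ℝ) - 1) * (2 * k + 4 - r)) ∧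
        (k = (r - 2) / 2 → (Even r ∨ (Odd r ∧ 2 * lam < 1 - 2 / (r : ℝ))) →
          Real.log rc⁻¹ < 0 ∧ 1 < rc)) ∧
    (∃ t w : Fin r → ℂ,
      EllipticSeries.IsWellPoisedBalanced
        (Fin.cons (EllipticSeries.qPow τ N M χ 1) t) w
        (EllipticSeries.qPow τ N M χ 1) (EllipticSeries.base τ) ∧
      EllipticSeries.OffLine τ N M χ t w ∧
      1 < EllipticSeries.radiusE
        (Fin.cons (EllipticSeries.qPow τ N M χ 1) t : Fin (r + 1) → ℂ) w
        (EllipticSeries.qPow τ N M χ 1) (EllipticSeries.base τ)) := by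
  have hr0 : (2 : ℝ) < r := by exact_mod_cast hr
  have hn : (0 : ℝ) < ‖(N : ℂ) + M * τ‖ ^ 2 :=
    pow_pos (norm_pos_iff.2 (EllipticSeries.period_ne_zero hτ hNM)) 2
  refine ⟨?_, ?_⟩
  · intro k lam ε h h' φ φ' hk hl0 hl1 hε hφ hφs hhs hφt hht p q t w
    have hφ' := EllipticSeries.eq_of_add_const_of_sum_eq hr hφ hφs hφt
    obtain ⟨hne, hne', hrad⟩ := EllipticSeries.radiusE_special hτ hNM hχ hr hk hl0 hl1 hε hφ hφ'
      hφs hhs hφt hht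
    refine ⟨hφ', EllipticSeries.isWellPoisedBalanced_param hτ hNM hχ hne hne' hφs hhs hφt hht,
      EllipticSeries.offLine_param hτ hNM χ hne hne', _, Real.exp_pos _, hrad, ?_, ?_⟩
    · rw [← Real.exp_neg, neg_neg, Real.log_exp]
    · intro hkr hpar
      have hε0 : 0 < ε := by rw [hε]; positivity
      have hneg := mul_neg_of_pos_of_neg
        (show 0 < ε * Real.pi * τ.im / ‖(N : ℂ) + M * τ‖ ^ 2 by positivity)
        (EllipticSeries.factor_neg hr hl1 hkr hpar)
      rw [← Real.exp_neg, neg_neg, Real.log_exp]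
      exact ⟨hneg, Real.one_lt_exp_iff.2 (by linarith)⟩
  · obtain ⟨k, hkdef⟩ : ∃ k, k = (r - 2) / 2 := ⟨_, rfl⟩
    -- Half of the bound for odd r, so one choice serves both parities.
    obtain ⟨lam, hlam⟩ : ∃ lam : ℝ, lam = (1 - 2 / (r : ℝ)) / 4 := ⟨_, rfl⟩
    obtain ⟨ε, hε⟩ : ∃ ε : ℝ, ε = ((k : ℝ) + 1) / ((r : ℝ) / 2 + lam) := ⟨_, rfl⟩
    obtain ⟨φ, hφ⟩ : ∃ φ : Fin r → ℝ, ∀ j, φ j = if (j : ℕ) = 0 then 1 + ε * r / 2 else 1 - ε :=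
      ⟨_, fun _ => rfl⟩
    obtain ⟨φ', hφ'⟩ : ∃ φ' : Fin r → ℝ, ∀ j, φ' j = if (j : ℕ) = 0 then
        1 - ε * (1 - 2 / (r : ℝ) + (r : ℝ) / 2) else 1 + 2 * ε / r := ⟨_, fun _ => rfl⟩
    have h2r : 2 / (r : ℝ) < 1 := (div_lt_one (by linarith)).2 hr0
    have hl0 : 0 < lam := by rw [hlam]; linarith
    have hl1 : 2 * lam < 1 - 2 / (r : ℝ) := by rw [hlam]; linarith
    have hk : (k : ℝ) + 1 ≤ (r : ℝ) / 2 := by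
      have : 2 * k + 2 ≤ r := by omega
      have : (2 * k + 2 : ℝ) ≤ r := by exact_mod_cast this
      linarith
    have hε0 : 0 < ε := by rw [hε]; positivity
    have hadd : ∀ j, φ' j + φ j = 2 + 2 * ε / r - ε := by
      intro j
      rw [hφ, hφ']
      split_ifs <;> ring
    have hφs : ∀ i j : Fin r, φ' i + φ i = φ' j + φ j := fun i j => by rw [hadd, hadd]
    have hφt : ∑ j, φ' j = ∑ j, φ j := by
      rw [Finset.sum_congr rfl fun j _ => hφ' j, Finset.sum_congr rfl fun j _ => hφ j,
        EllipticSeries.sum_ite_val_eq_zero (by omega),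
        EllipticSeries.sum_ite_val_eq_zero (by omega)]
      field_simp
      ring
    obtain ⟨hne, hne', hrad⟩ := EllipticSeries.radiusE_special (h := 0) (h' := 0) hτ hNM hχ hr hk
      hl0 (by linarith) hε hφ hφ' hφs (fun _ _ => rfl) hφt rfl
    refine ⟨_, _, EllipticSeries.isWellPoisedBalanced_param (h := 0) (h' := 0) hτ hNM hχ hne hne'
      hφs (fun _ _ => rfl) hφt rfl, EllipticSeries.offLine_param hτ hNM χ hne hne', ?_⟩
    rw [hrad, ENNReal.one_lt_ofReal, Real.one_lt_exp_iff]
    have hneg := mul_neg_of_pos_of_neg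
      (show 0 < ε * Real.pi * τ.im / ‖(N : ℂ) + M * τ‖ ^ 2 by positivity)
      (EllipticSeries.factor_neg hr (by linarith) hkdef
        ((Nat.even_or_odd r).imp_right fun ho => ⟨ho, hl1⟩))
    linarith
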